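/- Conventions. All rings are commutative. Let $(R,\mathfrak m)$ be a Noetherian local ring and $M$ a finitely generated $R$-module. The depth of $M$ is the supremum of the lengths of $M$-regular sequences of elements of $\mathfrak m$, and $M$ is Cohen-Macaulay if $M=0$ or $\operatorname{depth}_R M=\dim_R M$. For $M\neq 0$ put $\mathcal S(M)=\{\dim_R N \mid N \text{ an } R\text{-submodule of } M,\ N\neq 0\}=\{d_1<d_2<\dots<d_\ell\}$. The dimension filtration of $M$ is the chain $0=D_0\subsetneq D_1\subsetneq\dots\subsetneq D_\ell=M$ in which, for $1\le i\le \ell$, $D_i$ is the largest $R$-submodule of $M$ with $\dim_R D_i\le d_i$ (here $\dim_R 0=-\infty$). One says that $M$ is a sequentially Cohen-Macaulay $R$-module if $D_i/D_{i-1}$ is Cohen-Macaulay for every $1\le i\le\ell$, and that $R$ is a sequentially Cohen-Macaulay local ring if $\dim R<\infty$ and $R$ is a sequentially Cohen-Macaulay module over itself. Corollary. Let $A$ be a Noetherian local ring and let $G$ be a finite subgroup of the group $\operatorname{Aut}A$ of ring automorphisms of $A$. Suppose that the order of $G$ is invertible in $A$. If $A$ is a sequentially Cohen-Macaulay local ring,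 then the invariant subring $A^G=\{a\in A\mid g(a)=a\text{ for all }g\in G\}$ is a Noetherian local ring and is a sequentially Cohen-Macaulay local ring. -/

import Mathlib

/-- The depth of a finitely generated module `M` over a local ring `R`: the supremum of the lengths
of the `M`-regular sequences consisting of elements of the maximal ideal. -/
noncomputable def moduleDepth (R : Type*) [CommRing R] [IsLocalRing R]
    (M : Type*) [AddCommGroup M] [Module R M] : ℕ∞ :=
  ⨆ (rs : List R) (_ : ∀ r ∈ rs, r ∈ IsLocalRing.maximalIdeal R)
    (_ : RingTheory.Sequence.IsRegular M rs), (rs.length : ℕ∞)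

/-- A finitely generated module over a Noetherian local ring is Cohen-Macaulay if it is zero or if
its depth equals its dimension. -/
def IsCohenMacaulayModule (R : Type*) [CommRing R] [IsLocalRing R]
    (M : Type*) [AddCommGroup M] [Module R M] : Prop :=
  Subsingleton M ∨ (moduleDepth R M : WithBot ℕ∞) = Module.supportDim R M

/-- The set `𝒮(M)` of the dimensions of the nonzero submodules of `M`. -/
def submoduleDims (R : Type*) [CommRing R] (M : Type*) [AddCommGroup M] [Module R M] :
    Set (WithBot ℕ∞) :=
  {d | ∃ N : Submodule R M, N ≠ ⊥ ∧ Module.supportDim R N = d}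

/-- `D 0, …, D ℓ` is the dimension filtration of `M`: writing `𝒮(M) = {d₁ < ⋯ < d_ℓ}`, one has
`D 0 = 0`, and `D i` is the largest submodule of `M` of dimension at most `dᵢ` for `1 ≤ i ≤ ℓ`.
(Below, `d i` for `i : Fin ℓ` is `dᵢ₊₁`.) -/
def IsDimensionFiltration (R : Type*) [CommRing R] {M : Type*} [AddCommGroup M] [Module R M]
    {ℓ : ℕ} (D : Fin (ℓ + 1) → Submodule R M) : Prop :=
  D 0 = ⊥ ∧
    ∃ d : Fin ℓ → WithBot ℕ∞, StrictMono d ∧ Set.range d = submoduleDims R M ∧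
      ∀ i : Fin ℓ, IsGreatest {N : Submodule R M | Module.supportDim R N ≤ d i} (D i.succ)

/-- `M` is a sequentially Cohen-Macaulay module over the local ring `R`: all the quotients
`D i / D (i - 1)`, `1 ≤ i ≤ ℓ`, of its dimension filtration are Cohen-Macaulay. -/
def IsSequentiallyCMModule (R : Type*) [CommRing R] [IsLocalRing R]
    (M : Type*) [AddCommGroup M] [Module R M] : Prop :=
  ∃ (ℓ : ℕ) (D : Fin (ℓ + 1) → Submodule R M), IsDimensionFiltration R D ∧
    ∀ i : Fin ℓ,
      IsCohenMacaulayModule R (D i.succ ⧸ (D i.castSucc).submoduleOf (D i.succ))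

/-- A local ring `R` is sequentially Cohen-Macaulay if it has finite dimension and is a sequentially
Cohen-Macaulay module over itself. -/
def IsSequentiallyCMRing (R : Type*) [CommRing R] [IsLocalRing R] : Prop :=
  ringKrullDim R < ⊤ ∧ IsSequentiallyCMModule R R

/-! Put R = A^G. Averaging over G (the Reynolds operator) splits R → A over R, and A is a finite
R-module, so the claim is descent along a split finite local extension,
`IsSequentiallyCMRing.of_retraction`. Dimensions agree over R and over A, so contracting the
dimension filtration of A gives that of R, up to repeated terms, and the splitting makes each
filtration quotient of R a retract of one of A. Cohen-Macaulayness passes to such a retract: by the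
Ext criterion for depth, a maximal regular sequence can be chosen in the maximal ideal of R
(`exists_isWeaklyRegular_of_isRegular`); it stays regular on the retract, and its length bounds the
dimension there. -/

open Module RingTheory.Sequence IsLocalRing Order

universe u

/-! ### Dimension along integral extensions. -/

section Dimension

/-- An injective integral extension of rings preserves the Krull dimension. -/
theorem ringKrullDim_eq_of_isIntegral_of_injective {R S : Type*} [CommRing R] [CommRing S]
    [Algebra R S] [Algebra.IsIntegral R S] (h : Function.Injective (algebraMap R S)) :
    ringKrullDim R = ringKrullDim S := by
  apply le_antisymm
  · refine iSup_le fun l ↦ ?_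
    obtain ⟨P, -, _, hPl⟩ := Ideal.exists_ideal_over_prime_of_isIntegral (S := S)
      l.head.asIdeal ⊥ (by simp [← RingHom.ker_eq_comap_bot, (RingHom.injective_iff_ker_eq_bot _).mp h])
    have : P.LiesOver l.head.asIdeal := ⟨hPl.symm⟩
    obtain ⟨L, hL, -, -⟩ := Ideal.exists_ltSeries_of_hasGoingUp l P
    exact hL ▸ L.length_le_krullDim
  · exact krullDim_le_of_strictMono (PrimeSpectrum.comap (algebraMap R S))
      fun _ _ hpq ↦ Ideal.IsIntegral.comap_lt_comap hpq

theorem Module.supportDim_le_of_annihilator_le {R M N : Type*} [CommRing R] [AddCommGroup M]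
    [Module R M] [AddCommGroup N] [Module R N] [Module.Finite R M] [Module.Finite R N]
    (h : annihilator R M ≤ annihilator R N) : supportDim R N ≤ supportDim R M := by
  rw [supportDim_eq_ringKrullDim_quotient_annihilator,
    supportDim_eq_ringKrullDim_quotient_annihilator]
  exact ringKrullDim_le_of_surjective (Ideal.Quotient.factor h) (Ideal.Quotient.factor_surjective h)

/-- The dimension of a module does not change under restriction of scalars along an integral
ring homomorphism. -/
theorem Module.supportDim_eq_of_isIntegral (R : Type*) {S : Type*} (M : Type*) [CommRing R]
    [CommRing S] [Algebra R S] [Algebra.IsIntegral R S] [AddCommGroup M] [Module R M] [Module S M]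
    [IsScalarTower R S M] [Module.Finite R M] : supportDim R M = supportDim S M := by
  have : Module.Finite S M := Module.Finite.of_restrictScalars_finite R S M
  rw [supportDim_eq_ringKrullDim_quotient_annihilator,
    supportDim_eq_ringKrullDim_quotient_annihilator]
  have h : annihilator R M = (annihilator S M).comap (algebraMap R S) := by
    ext r
    simp [mem_annihilator]
  rw [h]
  exact ringKrullDim_eq_of_isIntegral_of_injective Ideal.algebraMap_quotient_injective

end Dimension

/-! ### Regular sequences: retracts and finite extensions. -/

section Regular

/-- A splitting survives reduction modulo `x`, whereas mere injectivity of `i` need not. -/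
theorem RingTheory.Sequence.IsWeaklyRegular.of_leftInverse {R M N : Type*} [CommRing R]
    [AddCommGroup M] [Module R M] [AddCommGroup N] [Module R N] (i : N →ₗ[R] M) (r : M →ₗ[R] N)
    (h : r ∘ₗ i = LinearMap.id) {rs : List R} (hrs : IsWeaklyRegular M rs) :
    IsWeaklyRegular N rs := by
  induction rs generalizing M N with
  | nil => simp
  | cons x rs ih =>
    rw [isWeaklyRegular_cons_iff] at hrs ⊢
    refine ⟨hrs.1.of_injective i (Function.LeftInverse.injective (LinearMap.congr_fun h)),
      ih (QuotSMulTop.map x i) (QuotSMulTop.map x r) ?_ hrs.2⟩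
    rw [← QuotSMulTop.map_comp, h, QuotSMulTop.map_id]

/-- If `Hom_S(S/IS, M) = 0`, then some element of `I` is `M`-regular. -/
theorem exists_isSMulRegular_algebraMap_of_subsingleton {R S M : Type*} [CommRing R]
    [IsNoetherianRing R] [CommRing S] [Algebra R S] [Module.Finite R S] [AddCommGroup M]
    [Module S M] [Module.Finite S M] (I : Ideal R)
    (h : Subsingleton ((S ⧸ I.map (algebraMap R S)) →ₗ[S] M)) :
    ∃ x ∈ I, IsSMulRegular M (algebraMap R S x) := by
  let _ : Module R M := Module.compHom M (algebraMap R S)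
  have : IsScalarTower R S M := .of_algebraMap_smul fun _ _ ↦ rfl
  have : Module.Finite R M := .trans S M
  have : Subsingleton ((R ⧸ I) →ₗ[R] M) := by
    refine subsingleton_of_forall_eq 0 fun f ↦ ?_
    -- `f 1` is killed by `I`, hence by `IS`, so `f` induces an `S`-linear map from `S/IS`.
    have hI : I.map (algebraMap R S) ≤ LinearMap.ker (LinearMap.toSpanSingleton S M (f 1)) := by
      refine Ideal.map_le_iff_le_comap.mpr fun x hx ↦ ?_
      have : f (x • 1) = 0 := by
        rw [← map_zero f]
        congr 1
        exact (Algebra.smul_def x (1 : R ⧸ I)).trans (by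
          rw [mul_one]; exact Ideal.Quotient.eq_zero_iff_mem.mpr hx)
      change algebraMap R S x • f 1 = 0
      rw [algebraMap_smul, ← map_smul, this]
    have h0 := LinearMap.congr_fun (Subsingleton.elim (Submodule.liftQ _ _ hI) 0)
      (Submodule.Quotient.mk 1)
    have h1 : f 1 = 0 := (one_smul S (f 1)).symm.trans h0
    ext
    simpa using h1
  obtain ⟨x, hx, hreg⟩ := IsSMulRegular.subsingleton_linearMap_iff.mp this
  rw [Ideal.annihilator_quotient] at hx
  exact ⟨x, hx, hreg⟩

open CategoryTheory Abelian Limits in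
-- Rees' induction: vanishing of Hom yields a regular element of `I`, and the long exact Ext
-- sequence passes the vanishing to the quotient by it, in one degree fewer.
theorem exists_isWeaklyRegular_map_of_subsingleton_ext {R : Type*} {S : Type u} [CommRing R]
    [IsNoetherianRing R] [CommRing S] [Algebra R S] [Module.Finite R S] (I : Ideal R)
    (n : ℕ) (M : ModuleCat.{u} S) [Module.Finite S M]
    (h : ∀ i < n, Subsingleton (Ext (ModuleCat.of S (S ⧸ I.map (algebraMap R S))) M i)) :
    ∃ rs : List R, rs.length = n ∧ (∀ r ∈ rs, r ∈ I) ∧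
      IsWeaklyRegular M (rs.map (algebraMap R S)) := by
  induction n generalizing M with
  | zero => exact ⟨[], by simp⟩
  | succ n ih =>
    have : Subsingleton (ModuleCat.of S (S ⧸ I.map (algebraMap R S)) ⟶ M) :=
      Ext.addEquiv₀.subsingleton_congr.mp (h 0 n.zero_lt_succ)
    have : Subsingleton ((S ⧸ I.map (algebraMap R S)) →ₗ[S] M) :=
      (ModuleCat.homAddEquiv (M := ModuleCat.of S (S ⧸ I.map (algebraMap R S)))).symm.subsingleton
    obtain ⟨x, hxI, hx⟩ := exists_isSMulRegular_algebraMap_of_subsingleton I this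
    obtain ⟨rs, hlen, hmem, hreg⟩ := ih (ModuleCat.of S (QuotSMulTop (algebraMap R S x) M)) <| by
      intro i hi
      have zero₁ := AddCommGrpCat.isZero_of_iff_subsingleton.mpr (h i (by omega))
      have zero₂ := AddCommGrpCat.isZero_of_iff_subsingleton.mpr (h (i + 1) (by omega))
      exact AddCommGrpCat.subsingleton_of_isZero <| ShortComplex.Exact.isZero_of_both_zeros
        ((Ext.covariant_sequence_exact₃' _ hx.smulShortComplex_shortExact) i (i + 1) rfl)
        (zero₁.eq_zero_of_src _) (zero₂.eq_zero_of_tgt _)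
    exact ⟨x :: rs, by simpa using hlen, by simpa using ⟨hxI, hmem⟩, by simpa using ⟨hx, hreg⟩⟩

/-- Along a finite homomorphism `R → S` of Noetherian local rings, every `M`-regular sequence
in the maximal ideal of `S` can be replaced by one of the same length in that of `R`. -/
theorem exists_isWeaklyRegular_of_isRegular (R : Type*) {S M : Type u} [CommRing R]
    [IsNoetherianRing R] [IsLocalRing R] [CommRing S] [IsNoetherianRing S] [IsLocalRing S]
    [Algebra R S] [Module.Finite R S] [AddCommGroup M] [Module S M] [Module R M]
    [IsScalarTower R S M] [Module.Finite S M] {ss : List S} (hmem : ∀ s ∈ ss, s ∈ maximalIdeal S)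
    (hss : IsRegular M ss) :
    ∃ rs : List R, rs.length = ss.length ∧ (∀ r ∈ rs, r ∈ maximalIdeal R) ∧
      IsWeaklyRegular M rs := by
  -- By integrality, the only prime of `S` over the maximal ideal of `R` is the maximal one.
  have hsupp : Module.support S (S ⧸ (maximalIdeal R).map (algebraMap R S)) ⊆
      PrimeSpectrum.zeroLocus (maximalIdeal S) := by
    rw [Module.support_eq_zeroLocus, Ideal.annihilator_quotient]
    intro p hp
    have hle : maximalIdeal R ≤ p.asIdeal.comap (algebraMap R S) := Ideal.map_le_iff_le_comap.mp hp
    have hmax : (p.asIdeal.comap (algebraMap R S)).IsMaximal := by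
      rw [← (maximalIdeal.isMaximal R).eq_of_le (Ideal.IsPrime.ne_top inferInstance) hle]
      infer_instance
    exact (eq_maximalIdeal (Ideal.IsIntegral.isMaximal_of_isMaximal_comap p.asIdeal hmax)).ge
  have : Nontrivial M := hss.nontrivial
  have hlt : maximalIdeal S • (⊤ : Submodule S M) < ⊤ := lt_top_iff_ne_top.mpr
    (Submodule.top_ne_ideal_smul_of_le_jacobson_annihilator (maximalIdeal_le_jacobson _)).symm
  obtain ⟨rs, hlen, hrs, hreg⟩ := exists_isWeaklyRegular_map_of_subsingleton_ext
    (maximalIdeal R) ss.length (ModuleCat.of S M) <|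
      ModuleCat.subsingleton_ext_of_exists_isRegular (maximalIdeal S)
        (ModuleCat.of S (S ⧸ (maximalIdeal R).map (algebraMap R S))) hsupp
        (ModuleCat.of S M) hlt ss hmem hss
  exact ⟨rs, hlen, hrs, (isWeaklyRegular_map_algebraMap_iff S M rs).mp hreg⟩

end Regular

/-! ### Dimension filtrations and descent of Cohen-Macaulayness. -/

section SequentiallyCM

theorem IsDimensionFiltration.finite_submoduleDims {R M : Type*} [CommRing R] [AddCommGroup M]
    [Module R M] {ℓ : ℕ} {D : Fin (ℓ + 1) → Submodule R M} (h : IsDimensionFiltration R D) :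
    (submoduleDims R M).Finite := by
  obtain ⟨-, d, -, hd, -⟩ := h
  exact hd ▸ Set.finite_range d

theorem bot_lt_of_mem_submoduleDims {R M : Type*} [CommRing R] [AddCommGroup M] [Module R M]
    {c : WithBot ℕ∞} (hc : c ∈ submoduleDims R M) : ⊥ < c := by
  obtain ⟨N, hN, rfl⟩ := hc
  have := Submodule.nontrivial_iff_ne_bot.mpr hN
  exact bot_lt_iff_ne_bot.mpr (supportDim_ne_bot_of_nontrivial R N)

/-- No submodule has dimension strictly between consecutive `d`'s. This characterizes the previous
term without indices, so filtrations of different lengths can be compared. -/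
theorem isGreatest_castSucc_of_isGreatest_succ {R M : Type*} [CommRing R] [AddCommGroup M]
    [Module R M] {ℓ : ℕ} {D : Fin (ℓ + 1) → Submodule R M} (h0 : D 0 = ⊥)
    {d : Fin ℓ → WithBot ℕ∞} (hmono : StrictMono d) (hd : Set.range d = submoduleDims R M)
    (hD : ∀ i : Fin ℓ, IsGreatest {N : Submodule R M | supportDim R N ≤ d i} (D i.succ))
    (i : Fin ℓ) :
    IsGreatest {N : Submodule R M | supportDim R N < d i} (D i.castSucc) := by
  have hlt (N : Submodule R M) (hN : supportDim R N < d i) :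
      N = ⊥ ∨ ∃ j < i, supportDim R N = d j := by
    refine or_iff_not_imp_left.mpr fun hbot ↦ ?_
    obtain ⟨j, hj⟩ : supportDim R N ∈ Set.range d := hd ▸ ⟨N, hbot, rfl⟩
    exact ⟨j, hmono.lt_iff_lt.mp (hj.trans_lt hN), hj.symm⟩
  obtain hi | ⟨j, hj⟩ := Fin.eq_zero_or_eq_succ i.castSucc
  · rw [hi, h0]
    constructor
    · rw [Set.mem_ofPred_eq, supportDim_eq_bot_of_subsingleton]
      exact bot_lt_of_mem_submoduleDims (hd ▸ Set.mem_range_self i)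
    · intro N hN
      obtain rfl | ⟨j, hj, -⟩ := hlt N hN
      · exact le_rfl
      · simp only [Fin.ext_iff, Fin.lt_def, Fin.val_castSucc, Fin.val_zero] at hi hj
        omega
  · rw [hj]
    have hji : j < i := by
      simp only [Fin.ext_iff, Fin.lt_def, Fin.val_castSucc, Fin.val_succ] at hj ⊢
      omega
    refine ⟨(hD j).1.trans_lt (hmono hji), fun N hN ↦ ?_⟩
    obtain rfl | ⟨k, hk, hNk⟩ := hlt N hN
    · exact bot_le
    · refine (hD j).2 (hNk.trans_le (hmono.monotone ?_))
      simp only [Fin.ext_iff, Fin.lt_def, Fin.le_def, Fin.val_castSucc, Fin.val_succ] at hj hk ⊢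
      omega

/-- A module is sequentially Cohen-Macaulay if and only if its nonzero submodules have finitely
many dimensions and, for each such dimension `c`, the quotient of the largest submodule of
dimension at most `c` by the largest submodule of dimension less than `c` is Cohen-Macaulay. -/
theorem isSequentiallyCMModule_iff {R M : Type*} [CommRing R] [IsLocalRing R] [AddCommGroup M]
    [Module R M] :
    IsSequentiallyCMModule R M ↔ (submoduleDims R M).Finite ∧
      ∀ c ∈ submoduleDims R M, ∃ D D' : Submodule R M,
        IsGreatest {N : Submodule R M | supportDim R N ≤ c} D ∧
        IsGreatest {N : Submodule R M | supportDim R N < c} D' ∧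
        IsCohenMacaulayModule R (D ⧸ D'.submoduleOf D) := by
  constructor
  · rintro ⟨ℓ, D, hD, hCM⟩
    refine ⟨hD.finite_submoduleDims, fun c hc ↦ ?_⟩
    obtain ⟨h0, d, hmono, hd, hgr⟩ := hD
    obtain ⟨i, rfl⟩ : c ∈ Set.range d := by rwa [hd]
    exact ⟨_, _, hgr i, isGreatest_castSucc_of_isGreatest_succ h0 hmono hd hgr i, hCM i⟩
  · rintro ⟨hfin, h⟩
    choose! D D' hD hD' hCM using h
    let d := hfin.toFinset.orderEmbOfFin rfl
    have hd : Set.range d = submoduleDims R M := by simp [d]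
    have hmem (i) : d i ∈ submoduleDims R M := hd.le (Set.mem_range_self i)
    let E : Fin (hfin.toFinset.card + 1) → Submodule R M := Fin.cons ⊥ fun i ↦ D (d i)
    have hE (i : Fin hfin.toFinset.card) : IsGreatest {N : Submodule R M | supportDim R N ≤ d i}
        (E i.succ) := hD _ (hmem i)
    refine ⟨_, E, ⟨rfl, d, d.strictMono, hd, hE⟩, fun i ↦ ?_⟩
    rw [(isGreatest_castSucc_of_isGreatest_succ rfl d.strictMono hd hE i).unique
      (hD' _ (hmem i))]
    exact hCM _ (hmem i)

theorem IsCohenMacaulayModule.exists_isRegular {R M : Type*} [CommRing R] [IsLocalRing R]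
    [AddCommGroup M] [Module R M] [Nontrivial M] (h : IsCohenMacaulayModule R M)
    (hdim : supportDim R M < ⊤) :
    ∃ rs : List R, (∀ r ∈ rs, r ∈ maximalIdeal R) ∧ IsRegular M rs ∧
      (rs.length : WithBot ℕ∞) = supportDim R M := by
  have h := h.resolve_left (not_subsingleton M)
  rw [← h] at hdim ⊢
  obtain ⟨n, hn⟩ := ENat.ne_top_iff_exists.mp (WithBot.coe_lt_coe.mp hdim).ne
  rw [← hn]
  by_contra! hcon
  have hlt : ∀ rs : List R, (∀ r ∈ rs, r ∈ maximalIdeal R) → IsRegular M rs →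
      rs.length < n := by
    intro rs hmem hreg
    refine lt_of_le_of_ne ?_ fun hlen ↦ hcon rs hmem hreg (by rw [hlen]; rfl)
    have : (rs.length : ℕ∞) ≤ moduleDepth R M := le_iSup₂_of_le rs hmem (le_iSup_of_le hreg le_rfl)
    exact_mod_cast hn ▸ this
  -- The empty sequence is regular on a nonzero module; for `n = 0` the truncated `n - 1` would give
  -- no contradiction.
  have hpos : 0 < n := hlt [] (by simp) (.nil R M)
  have : (n : ℕ∞) ≤ (n - 1 : ℕ) := by
    rw [hn]
    refine iSup₂_le fun rs hmem ↦ iSup_le fun hreg ↦ ?_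
    have := hlt rs hmem hreg
    exact_mod_cast (by omega : rs.length ≤ n - 1)
  have : n ≤ n - 1 := by exact_mod_cast this
  omega

/-- Depth never exceeds dimension, since dividing by a regular sequence lowers the dimension by its
length. -/
theorem IsCohenMacaulayModule.of_isRegular {R M : Type*} [CommRing R] [IsNoetherianRing R]
    [IsLocalRing R] [AddCommGroup M] [Module R M] [Module.Finite R M] {rs : List R}
    (hmem : ∀ r ∈ rs, r ∈ maximalIdeal R) (hreg : IsRegular M rs)
    (hdim : supportDim R M ≤ rs.length) : IsCohenMacaulayModule R M := by
  refine Or.inr (le_antisymm ?_ (hdim.trans ?_))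
  · have : Nontrivial M := hreg.nontrivial
    obtain ⟨e, he⟩ := WithBot.ne_bot_iff_exists.mp (supportDim_ne_bot_of_nontrivial R M)
    rw [← he, WithBot.coe_le_coe]
    refine iSup₂_le fun ss _ ↦ iSup_le fun hss ↦ ?_
    rw [← WithBot.coe_le_coe, he, ← supportDim_add_length_eq_supportDim_of_isRegular ss hss]
    have := hss.quot_ofList_smul_nontrivial ⊤
    refine le_add_of_nonneg_left ?_
    obtain ⟨a, ha⟩ := WithBot.ne_bot_iff_exists.mp
      (supportDim_ne_bot_of_nontrivial R (M ⧸ Ideal.ofList ss • (⊤ : Submodule R M)))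
    rw [← ha]
    exact WithBot.coe_le_coe.mpr bot_le
  · have : (rs.length : ℕ∞) ≤ moduleDepth R M := le_iSup₂_of_le rs hmem (le_iSup_of_le hreg le_rfl)
    exact WithBot.coe_le_coe.mpr this

/-- A module over `R` which is a retract of a Cohen-Macaulay module of the same dimension over a
finite local extension `S` is Cohen-Macaulay. -/
theorem IsCohenMacaulayModule.of_leftInverse {R : Type*} {S M : Type u} {N : Type*} [CommRing R]
    [IsNoetherianRing R] [IsLocalRing R] [CommRing S] [IsNoetherianRing S] [IsLocalRing S]
    [Algebra R S] [Module.Finite R S] [AddCommGroup M] [Module S M] [Module R M]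
    [IsScalarTower R S M] [Module.Finite S M] [AddCommGroup N] [Module R N]
    (i : N →ₗ[R] M) (r : M →ₗ[R] N) (h : r ∘ₗ i = LinearMap.id)
    (hM : IsCohenMacaulayModule S M) : IsCohenMacaulayModule R N := by
  obtain hN | hN := subsingleton_or_nontrivial N
  · exact .inl hN
  have hi : Function.Injective i := Function.LeftInverse.injective (LinearMap.congr_fun h)
  have : Nontrivial M := hi.nontrivial
  have : Module.Finite R M := .trans S M
  have : Module.Finite R N := .of_surjective r (Function.RightInverse.surjective
    (LinearMap.congr_fun h))
  obtain ⟨ss, hss, hreg, hlen⟩ := hM.exists_isRegular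
    ((supportDim_le_ringKrullDim S M).trans_lt ringKrullDim_lt_top)
  obtain ⟨rs, hrs, hmem, hreg'⟩ := exists_isWeaklyRegular_of_isRegular R hss hreg
  refine .of_isRegular hmem
    (.of_isWeaklyRegular_of_mem_maximalIdeal N hmem (hreg'.of_leftInverse i r h)) ?_
  rw [hrs, hlen, ← supportDim_eq_of_isIntegral R (S := S) M]
  exact supportDim_le_of_injective i hi

/-- An element of `R` killing `I` also kills `IS`, and `I` embeds in `IS`. -/
theorem supportDim_idealMap_of_injective {R S : Type*} [CommRing R] [IsNoetherianRing R]
    [CommRing S] [Algebra R S] [Module.Finite R S] (hinj : Function.Injective (algebraMap R S))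
    (I : Ideal R) : supportDim S (I.map (algebraMap R S)) = supportDim R I := by
  have := isNoetherian_of_isNoetherianRing_of_finite R S
  rw [← supportDim_eq_of_isIntegral R]
  apply le_antisymm
  · refine supportDim_le_of_annihilator_le fun a ha ↦ ?_
    rw [mem_annihilator] at ha ⊢
    rintro ⟨x, hx⟩
    rw [Subtype.ext_iff]
    change a • x = 0
    have hle : I.map (algebraMap R S) ≤ LinearMap.ker (LinearMap.lsmul S S (algebraMap R S a)) := by
      refine Ideal.map_le_iff_le_comap.mpr fun y hy ↦ ?_
      have : a * y = 0 := congrArg Subtype.val (ha ⟨y, hy⟩)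
      change algebraMap R S a * algebraMap R S y = 0
      rw [← map_mul, this, map_zero]
    exact (Algebra.smul_def a x).trans (hle hx)
  · let f : I →ₗ[R] I.map (algebraMap R S) :=
      ((Algebra.linearMap R S).restrict (p := I)
        (q := (I.map (algebraMap R S)).restrictScalars R)
        fun x hx ↦ Ideal.mem_map_of_mem _ hx)
    refine supportDim_le_of_injective f fun x y hxy ↦ ?_
    exact Subtype.ext (hinj (congrArg Subtype.val hxy))

theorem supportDim_idealComap_le_of_injective {R S : Type*} [CommRing R] [IsNoetherianRing R]
    [CommRing S] [Algebra R S] [Module.Finite R S] (hinj : Function.Injective (algebraMap R S))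
    (J : Ideal S) : supportDim R (J.comap (algebraMap R S)) ≤ supportDim S J := by
  have := isNoetherian_of_isNoetherianRing_of_finite R S
  rw [← supportDim_eq_of_isIntegral R (S := S) J]
  let f : J.comap (algebraMap R S) →ₗ[R] J :=
    (Algebra.linearMap R S).restrict (p := J.comap (algebraMap R S))
      (q := J.restrictScalars R) fun x hx ↦ hx
  refine supportDim_le_of_injective f fun x y hxy ↦ ?_
  exact Subtype.ext (hinj (congrArg Subtype.val hxy))

/-- If `R → S` is a finite homomorphism of Noetherian local rings which splits as a map of
`R`-modules and `S` is sequentially Cohen-Macaulay, then so is `R`. -/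
theorem IsSequentiallyCMRing.of_retraction {R : Type*} {S : Type u} [CommRing R]
    [IsNoetherianRing R] [IsLocalRing R] [CommRing S] [IsNoetherianRing S] [IsLocalRing S]
    [Algebra R S] [Module.Finite R S] (ρ : S →ₗ[R] R) (hρ : ∀ x, ρ (algebraMap R S x) = x)
    (hS : IsSequentiallyCMRing S) : IsSequentiallyCMRing R := by
  have hinj : Function.Injective (algebraMap R S) := Function.LeftInverse.injective hρ
  have hdim (N : Submodule S S) : supportDim R N = supportDim S N :=
    supportDim_eq_of_isIntegral R N
  have hmap := supportDim_idealMap_of_injective hinj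
  have hcomap := supportDim_idealComap_le_of_injective hinj
  have hsub : submoduleDims R R ⊆ submoduleDims S S := by
    rintro _ ⟨I, hI, rfl⟩
    exact ⟨Ideal.map (algebraMap R S) I, (Ideal.map_eq_bot_iff_of_injective hinj).not.mpr hI, hmap I⟩
  obtain ⟨hfin, hCM⟩ := isSequentiallyCMModule_iff.mp hS.2
  refine ⟨ringKrullDim_lt_top, isSequentiallyCMModule_iff.mpr
    ⟨hfin.subset hsub, fun c hc ↦ ?_⟩⟩
  obtain ⟨D, D', hD, hD', hQ⟩ := hCM c (hsub hc)
  -- Extension and contraction of ideals are adjoint, and neither raises the dimension.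
  have hE : IsGreatest {N : Submodule R R | supportDim R N ≤ c}
      (Ideal.comap (algebraMap R S) D) :=
    ⟨(hcomap D).trans hD.1, fun I hI ↦
      Ideal.map_le_iff_le_comap.mp (hD.2 ((hmap I).trans_le hI))⟩
  have hE' : IsGreatest {N : Submodule R R | supportDim R N < c}
      (Ideal.comap (algebraMap R S) D') :=
    ⟨(hcomap D').trans_lt hD'.1, fun I hI ↦
      Ideal.map_le_iff_le_comap.mp (hD'.2 ((hmap I).trans_lt hI))⟩
  have hρdim (N : Submodule S S) :
      supportDim R ((N.restrictScalars R).map ρ) ≤ supportDim S N := by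
    rw [← hdim]
    exact supportDim_le_of_surjective (ρ.submoduleMap (N.restrictScalars R))
      (ρ.submoduleMap_surjective _)
  -- `ρ(D)` is an ideal of `R` that is a quotient of `D`, so its dimension is at most `c` and
  -- maximality applies.
  have hρD : ∀ x ∈ D, ρ x ∈ Ideal.comap (algebraMap R S) D := fun x hx ↦
    hE.2 ((hρdim D).trans hD.1) (Submodule.mem_map_of_mem hx)
  have hρD' : ∀ x ∈ D', ρ x ∈ Ideal.comap (algebraMap R S) D' := fun x hx ↦
    hE'.2 ((hρdim D').trans_lt hD'.1) (Submodule.mem_map_of_mem hx)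
  refine ⟨_, _, hE, hE', ?_⟩
  generalize hEe : Ideal.comap (algebraMap R S) D = E at *
  generalize hEe' : Ideal.comap (algebraMap R S) D' = E' at *
  let i₀ : E →ₗ[R] D := (Algebra.linearMap R S).restrict (p := E) (q := D.restrictScalars R)
    fun x hx ↦ by subst hEe; exact hx
  let r₀ : D →ₗ[R] E := ρ.restrict (p := D.restrictScalars R) (q := E) hρD
  let e := Submodule.Quotient.restrictScalarsEquiv R (D'.submoduleOf D)
  let i : (E ⧸ E'.submoduleOf E) →ₗ[R] (D ⧸ D'.submoduleOf D) := e.toLinearMap ∘ₗ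
    Submodule.mapQ _ ((D'.submoduleOf D).restrictScalars R) i₀ fun x hx ↦ by subst hEe'; exact hx
  let r : (D ⧸ D'.submoduleOf D) →ₗ[R] (E ⧸ E'.submoduleOf E) :=
    Submodule.mapQ ((D'.submoduleOf D).restrictScalars R) _ r₀ (fun x hx ↦ hρD' _ hx) ∘ₗ
      e.symm.toLinearMap
  refine .of_leftInverse i r ?_ hQ
  ext x
  change Submodule.Quotient.mk (r₀ (i₀ x)) = Submodule.Quotient.mk x
  congr 1
  exact Subtype.ext (hρ x)

end SequentiallyCM

/-! ### The Reynolds operator and finiteness over the invariants. -/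

section Invariants

variable {G A : Type*} [Group G] [Fintype G] [CommRing A] [MulSemiringAction G A]

theorem smul_eq_self_of_mul_card_eq_one {c : A} (hc : c * (Fintype.card G : A) = 1) (g : G) :
    g • c = c := by
  have h : g • c * (Fintype.card G : A) = 1 := by
    have := congrArg (g • ·) hc
    rwa [smul_mul', smul_one, ← MulSemiringAction.toRingHom_apply, ← MulSemiringAction.toRingHom_apply,
      map_natCast] at this
  calc g • c = g • c * (c * (Fintype.card G : A)) := by rw [hc, mul_one]
    _ = c * (g • c * (Fintype.card G : A)) := by ring
    _ = c := by rw [h, mul_one]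

/-- The Reynolds operator, the projection of a ring onto its ring of invariants given by averaging
over the group. -/
def reynolds (c : A) (hc : c * (Fintype.card G : A) = 1) :
    A →ₗ[FixedPoints.subring A G] FixedPoints.subring A G where
  toFun x := ⟨c * ∑ g : G, g • x, fun h ↦ by
    rw [smul_mul', smul_eq_self_of_mul_card_eq_one hc, Finset.smul_sum]
    congr 1
    simp_rw [smul_smul]
    exact Fintype.sum_equiv (Equiv.mulLeft h) _ _ fun _ ↦ rfl⟩
  map_add' x y := by
    ext
    simp [Finset.sum_add_distrib, mul_add]
  map_smul' b x := by
    ext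
    change c * ∑ g : G, g • ((b : A) * x) = (b : A) * (c * ∑ g : G, g • x)
    have hb (g : G) : g • (b : A) = b := b.2 g
    simp_rw [smul_mul', hb, ← Finset.mul_sum]
    ring

theorem reynolds_algebraMap (c : A) (hc : c * (Fintype.card G : A) = 1)
    (b : FixedPoints.subring A G) :
    reynolds c hc (algebraMap (FixedPoints.subring A G) A b) = b := by
  ext
  change c * ∑ g : G, g • (b : A) = b
  have hb (g : G) : g • (b : A) = b := b.2 g
  simp [hb, ← mul_assoc, hc]

/-- If a finite group `G` of invertible order acts on a Noetherian ring `A`, then `A` is a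
Noetherian module over the ring of invariants. -/
theorem isNoetherian_fixedPoints_subring [IsNoetherianRing A] (c : A)
    (hc : c * (Fintype.card G : A) = 1) : IsNoetherian (FixedPoints.subring A G) A := by
  let T : (G → A) →+ A :=
    { toFun f := c * ∑ h : G, h • f h⁻¹
      map_zero' := by simp
      map_add' f f' := by simp [Finset.sum_add_distrib, mul_add] }
  -- `F M` is the `A`-span of the orbit vectors of `M`. As `T` sends `a` times the orbit vector of
  -- `m` to the Reynolds average of `a` times `m`, `M` is recovered from `F M`; chains thus embed
  -- into those of the Noetherian `A`-module `G → A`.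
  let F (M : Submodule (FixedPoints.subring A G) A) : Submodule A (G → A) :=
    Submodule.span A ((fun m g ↦ g • m) '' (M : Set A))
  have hT (M : Submodule (FixedPoints.subring A G) A) (f : G → A) (hf : f ∈ F M) :
      ∀ a : A, T (a • f) ∈ M := by
    induction hf using Submodule.span_induction with
    | mem f hf =>
      obtain ⟨m, hm, rfl⟩ := hf
      intro a
      have : T (a • fun g : G ↦ g • m) = reynolds c hc a • m := by
        change c * ∑ h : G, h • (a * h⁻¹ • m) = (c * ∑ h : G, h • a) * m
        simp [smul_mul', mul_assoc, Finset.sum_mul]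
      exact this ▸ M.smul_mem _ hm
    | zero => simp
    | add f f' _ _ hf hf' =>
      intro a
      rw [smul_add, map_add]
      exact M.add_mem (hf a) (hf' a)
    | smul b f _ hf =>
      intro a
      rw [smul_smul]
      exact hf _
  have hmem (M : Submodule (FixedPoints.subring A G) A) (m : A) :
      (fun g : G ↦ g • m) ∈ F M ↔ m ∈ M := by
    refine ⟨fun h ↦ ?_, fun h ↦ Submodule.subset_span ⟨m, h, rfl⟩⟩
    have hm : T ((1 : A) • fun g : G ↦ g • m) = m := by
      change c * ∑ h : G, h • ((1 : A) * h⁻¹ • m) = m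
      simp [← mul_assoc, hc]
    exact hm ▸ hT M _ h 1
  have hF : StrictMono F := by
    refine Monotone.strictMono_of_injective
      (fun M M' h ↦ Submodule.span_mono (Set.image_mono h)) fun M M' h ↦ ?_
    ext m
    rw [← hmem M, h, hmem]
  rw [isNoetherian_iff']
  exact hF.wellFoundedGT

end Invariants

theorem corollary3p7 {A : Type*} [CommRing A] [IsLocalRing A] [IsNoetherianRing A]
    (G : Subgroup (RingAut A)) [Finite G] (hG : IsUnit ((Nat.card G : ℕ) : A))
    (hA : IsSequentiallyCMRing A) :
    IsNoetherianRing (FixedPoints.subring A G) ∧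
      ∃ _ : IsLocalRing (FixedPoints.subring A G),
        IsSequentiallyCMRing (FixedPoints.subring A G) := by
  have := Fintype.ofFinite G
  obtain ⟨c, hc⟩ := hG.exists_left_inv
  rw [Nat.card_eq_fintype_card] at hc
  have hnoeth := isNoetherian_fixedPoints_subring c hc
  have hinj : Function.Injective (algebraMap (FixedPoints.subring A G) A) :=
    Subtype.val_injective
  have hR : IsNoetherianRing (FixedPoints.subring A G) :=
    isNoetherian_of_injective (Algebra.linearMap _ A) hinj
  -- The inclusion reflects units: the inverse of an invariant unit is invariant.
  have hloc : IsLocalRing (FixedPoints.subring A G) :=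
    (algebraMap (FixedPoints.subring A G) A).domain_isLocalRing
  exact ⟨hR, hloc, .of_retraction (reynolds c hc) (reynolds_algebraMap c hc) hA⟩
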